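/- Let $F$ be a field with an involution $r\mapsto r^*$ (possibly the identity) and let $V$ be an $F$-vector space of dimension $d\ge 3$ with a non-alternate, non-degenerate $*$-hermitean form $\langle\cdot|\cdot\rangle$; write $|v|=\langle v|v\rangle$. Suppose that $V$ admits an ON-basis, i.e. an orthogonal basis $v_1,\dots,v_d$ with $|v_1|=\dots=|v_d|$ (an orthonormal basis up to scaling of the form), and let $\bar\alpha=(1,\dots,1)$. Let $\mathsf L=\mathsf L(V)$ be the lattice of subspaces of $V$ with involution $U\mapsto U^\perp$, considered as a structure in the language $\Lambda_L$ with operations $+,0,{}^\perp$; let $\Lambda_F$ be the language of $*$-rings with constants $0,1$. For a basis $\bar v$ and $A\in F^{d\times d}$ let $\mathrm{Sp}_{\bar v}(A)=\mathrm{Span}\{\sum_i v_i a_{ij}\mid j=1,\dots,d\}$, and for $K\subseteq (F^{d\times d})^n$ let $\theta_{F\bar\alpha L}(K)\subseteq \mathsf L^n$ be the set of all $(\mathrm{Sp}_{\bar v}(A_1),\dots,\mathrm{Sp}_{\bar v}(A_n))$ where $(A_1,\dots,A_n)\in K$ and $\bar v$ is an ON-basis. Call $K$ $\bar\alpha$-bi-invariant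 if $(TA_1T_1,\dots,TA_nT_n)\in K$ for all $\bar A\in K$, all $T_i\in \mathrm{GL}(F,d)$ and all $T\in\mathrm{GL}(F,d)$ such that the conjugate transpose of $T$ equals $rT^{-1}$ for some $0\ne r=r^*\in F$. An orthonormal frame of $\mathsf L$ is a system $(a_{ij}\mid 1\le i,j\le d)$ of the form $a_{ii}=v_iF$, $a_{ij}=(v_j-v_i)F$ ($i\ne j$) with $\bar v$ an ON-basis. Let $\psi(X_1,\dots,X_n)$ be a $\Lambda_F$-formula in $n$ matrices of $d\times d$ variables, and let $K\subseteq (F^{d\times d})^n$ be the set it defines in $F$. We say that $\psi$ hides coordinate systems if there are finitely many pairs of tuples $\bar a^k(\bar x)=(a^k_{ij}(x_1,\dots,x_n))_{1\le i,j\le d}$ and $\bar t^k(\bar z)=(t^k_1,\dots,t^k_n)$ of $\Lambda_L$-terms such that for each $\bar u\in\theta_{F\bar\alpha L}(K)$ there is $k$ such that $\bar a^k(\bar u)$ is an orthonormal frame and $\bar u=\bar t^k(\bar a^k(\bar u))$. If $\psi$ is quantifier free and hides coordinate systems, and if $K$ is $\bar\alpha$-bi-invariant, then $M=\theta_{F\bar\alpha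 L}(K)$ is defined within $\mathsf L$ by a quantifier-free $\Lambda_L$-formula $\phi(x_1,\dots,x_n)$. -/

import Mathlib

open FirstOrder

noncomputable section

/-! ### The two first-order languages -/

/-- Function symbols of bounded lattices with involution: `0`, `⊥` (orthogonal), `+` (join). -/
inductive InvLatticeFunc : ℕ → Type
  | zero : InvLatticeFunc 0
  | perp : InvLatticeFunc 1
  | join : InvLatticeFunc 2

/-- The language `Λ_L` of bounded lattices with involution (no relation symbol but equality).
Meet and top are the derived terms `(s^⊥ + t^⊥)^⊥` and `0^⊥`. -/
def invLattice : FirstOrder.Language := ⟨InvLatticeFunc, fun _ => Empty⟩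

/-- Function symbols of `*`-rings with constants `0` and `1`. -/
inductive StarRingFunc : ℕ → Type
  | zero : StarRingFunc 0
  | one : StarRingFunc 0
  | neg : StarRingFunc 1
  | star : StarRingFunc 1
  | add : StarRingFunc 2
  | mul : StarRingFunc 2

/-- The language `Λ_F` of `*`-rings (no relation symbol but equality). -/
def starRingLang : FirstOrder.Language := ⟨StarRingFunc, fun _ => Empty⟩

/-- A field with involution as a structure for the language of `*`-rings. -/
instance starRingStructure (F : Type*) [Field F] [StarRing F] : starRingLang.Structure F where
  funMap := fun {_} f x => match f, x with
    | StarRingFunc.zero, _ => 0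
    | StarRingFunc.one, _ => 1
    | StarRingFunc.neg, x => -(x 0)
    | StarRingFunc.star, x => star (x 0)
    | StarRingFunc.add, x => x 0 + x 1
    | StarRingFunc.mul, x => x 0 * x 1
  RelMap := fun {_} r _ => nomatch r

/-! ### Inner product spaces over a field with involution -/

/-- A non-alternate, non-degenerate `*`-hermitean form. The type of `B` says that `B` is additive in
both arguments with `B (r • v) (s • w) = star r * B v w * s`. -/
structure IsInnerProductForm {F V : Type*} [Field F] [StarRing F] [AddCommGroup V] [Module F V]
    (B : V →ₗ⋆[F] V →ₗ[F] F) : Prop where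
  hermitian : ∀ v w, B w v = star (B v w)
  nonAlternate : ∃ v, B v v ≠ 0
  nondegenerate : ∀ v, (∀ w, B w v = 0) → v = 0

section Space

variable {F V : Type*} [Field F] [StarRing F] [AddCommGroup V] [Module F V]

/-- The lattice of all subspaces of `V` with the involution `U ↦ U^⊥ = {x | ∀ u ∈ U, B u x = 0}`
(for hermitean `B` the order of the arguments is irrelevant), as a structure for the language of
bounded lattices with involution. -/
@[reducible] def subspaceStructure (B : V →ₗ⋆[F] V →ₗ[F] F) : invLattice.Structure (Submodule F V) where
  funMap := fun {_} f x => match f, x with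
    | InvLatticeFunc.zero, _ => ⊥
    | InvLatticeFunc.perp, x => (x 0).orthogonalBilin B
    | InvLatticeFunc.join, x => x 0 ⊔ x 1
  RelMap := fun {_} r _ => nomatch r

/-- The value of a lattice term in the subspace lattice. -/
def latticeEval (B : V →ₗ⋆[F] V →ₗ[F] F) {ι : Type*} (t : invLattice.Term ι)
    (u : ι → Submodule F V) : Submodule F V :=
  letI := subspaceStructure B
  t.realize u

/-- Validity of a lattice formula in the subspace lattice, `L(V) ⊨ φ(u)`. -/
def LatticeHolds (B : V →ₗ⋆[F] V →ₗ[F] F) {ι : Type*} (φ : invLattice.Formula ι)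
    (u : ι → Submodule F V) : Prop :=
  letI := subspaceStructure B
  φ.Realize u

/-- `M` can be defined within the subspace lattice by a quantifier-free formula
(without parameters). -/
def QFDefinableInLattice (B : V →ₗ⋆[F] V →ₗ[F] F) {n : ℕ} (M : Set (Fin n → Submodule F V)) :
    Prop :=
  ∃ φ : invLattice.Formula (Fin n), φ.IsQF ∧ ∀ u, u ∈ M ↔ LatticeHolds B φ u

/-- A basis `v` is orthogonal. -/
def IsOrthogonalBasis (B : V →ₗ⋆[F] V →ₗ[F] F) {d : ℕ} (v : Module.Basis (Fin d) F V) : Prop :=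
  ∀ i j, i ≠ j → B (v i) (v j) = 0

/-- The normalized form constants `(1, |v₁|⁻¹|v₂|, …, |v₁|⁻¹|v_d|)` of a basis, with
`|w| = B w w`. -/
def formConstants (B : V →ₗ⋆[F] V →ₗ[F] F) {d : ℕ} [NeZero d] (v : Module.Basis (Fin d) F V) :
    Fin d → F :=
  fun i => (B (v 0) (v 0))⁻¹ * B (v i) (v i)

/-- `v` is an orthogonal basis with normalized form constants `α`. For `α = (1, …, 1)` this is an
orthonormal basis, up to a common scaling of the form. -/
def IsAlphaBasis (B : V →ₗ⋆[F] V →ₗ[F] F) {d : ℕ} [NeZero d] (α : Fin d → F)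
    (v : Module.Basis (Fin d) F V) : Prop :=
  IsOrthogonalBasis B v ∧ formConstants B v = α

/-- The span of the columns of a matrix, `V` being identified with `F^d` via the basis `v`. -/
def columnSpan {d : ℕ} (v : Module.Basis (Fin d) F V) (A : Matrix (Fin d) (Fin d) F) :
    Submodule F V :=
  Submodule.span F (Set.range fun j => ∑ i, A i j • v i)

/-- `θ_{F v L}(K)`: all tuples of column spans, with respect to `v`, of members of `K`. -/
def thetaBasis {d n : ℕ} (v : Module.Basis (Fin d) F V)
    (K : Set (Fin n → Matrix (Fin d) (Fin d) F)) : Set (Fin n → Submodule F V) :=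
  {u | ∃ A ∈ K, ∀ k, u k = columnSpan v (A k)}

/-- `θ_{F α L}(K)`: the union of the `θ_{F v L}(K)` over all orthogonal bases `v` with normalized
form constants `α`. -/
def thetaAlpha (B : V →ₗ⋆[F] V →ₗ[F] F) {d n : ℕ} [NeZero d] (α : Fin d → F)
    (K : Set (Fin n → Matrix (Fin d) (Fin d) F)) : Set (Fin n → Submodule F V) :=
  {u | ∃ v : Module.Basis (Fin d) F V, IsAlphaBasis B α v ∧ u ∈ thetaBasis v K}

/-- The frame associated with a basis `v`: `a_ii = v_i F` and `a_ij = (v_j - v_i) F` for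
`i ≠ j`. -/
def basisFrame {d : ℕ} (v : Module.Basis (Fin d) F V) (i j : Fin d) : Submodule F V :=
  if i = j then Submodule.span F {v i} else Submodule.span F {v j - v i}

/-- `a` is an `α`-frame: a frame associated with an orthogonal basis whose normalized form constants
are `α`. For `α = (1, …, 1)` it is an orthonormal frame. -/
def IsAlphaFrame (B : V →ₗ⋆[F] V →ₗ[F] F) {d : ℕ} [NeZero d] (α : Fin d → F)
    (a : Fin d → Fin d → Submodule F V) : Prop :=
  ∃ v : Module.Basis (Fin d) F V, IsAlphaBasis B α v ∧ ∀ i j, a i j = basisFrame v i j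

end Space

/-! ### Matrices -/

section Matrices

variable {F : Type*} [Field F] [StarRing F]

/-- `T^{†_α} = D_α⁻¹ T^* D_α` with `D_α` the diagonal matrix of `α`. -/
def alphaAdjoint {d : ℕ} (α : Fin d → F) (T : Matrix (Fin d) (Fin d) F) :
    Matrix (Fin d) (Fin d) F :=
  (Matrix.diagonal α)⁻¹ * T.conjTranspose * Matrix.diagonal α

/-- Membership in `O⁺_α(F, d)`: invertible `T` with `T^{†_α} = r T⁻¹` for some `0 ≠ r = r^*`. -/
def IsScaledOrthogonal {d : ℕ} (α : Fin d → F) (T : Matrix.GeneralLinearGroup (Fin d) F) : Prop :=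
  ∃ r : F, r ≠ 0 ∧ star r = r ∧
    alphaAdjoint α (T : Matrix (Fin d) (Fin d) F) =
      r • ((T⁻¹ : Matrix.GeneralLinearGroup (Fin d) F) : Matrix (Fin d) (Fin d) F)

/-- `K` is `α`-bi-invariant. -/
def IsBiInvariant {d n : ℕ} (α : Fin d → F) (K : Set (Fin n → Matrix (Fin d) (Fin d) F)) : Prop :=
  ∀ A ∈ K, ∀ T : Matrix.GeneralLinearGroup (Fin d) F, IsScaledOrthogonal α T →
    ∀ S : Fin n → Matrix.GeneralLinearGroup (Fin d) F,
      (fun k => (T : Matrix (Fin d) (Fin d) F) * A k * (S k : Matrix (Fin d) (Fin d) F)) ∈ K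

/-- The set of `n`-tuples of `d × d`-matrices defined in `F` by a formula of the language of
`*`-rings; the variable `(k, i, j)` stands for the entry `(i, j)` of the `k`-th matrix. -/
def matrixSet (F : Type*) [Field F] [StarRing F] {d n : ℕ}
    (ψ : starRingLang.Formula (Fin n × Fin d × Fin d)) :
    Set (Fin n → Matrix (Fin d) (Fin d) F) :=
  {A | ψ.Realize fun p => A p.1 p.2.1 p.2.2}

end Matrices

/-! ### Hidden coordinate systems -/

/-- `ψ` hides coordinate systems (for `V` with form `B`): there are finitely many pairs of tuples of
lattice terms `a^k(x)`, `t^k(z)` such that every tuple `u` of subspaces in `θ_{F α L}(K)`, with `K`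
the set defined by `ψ` and `α = (1, …, 1)`, has some `k` for which `a^k(u)` is an orthonormal frame
and `u = t^k(a^k(u))`. Membership in `θ_{F α L}(K)` is exactly what it means for `u` to satisfy the
translation of `ψ` into the language of lattices. -/
def HidesCoordinateSystems {F V : Type*} [Field F] [StarRing F] [AddCommGroup V] [Module F V]
    (B : V →ₗ⋆[F] V →ₗ[F] F) {d n : ℕ} [NeZero d]
    (ψ : starRingLang.Formula (Fin n × Fin d × Fin d)) : Prop :=
  ∃ (m : ℕ) (a : Fin m → Fin d → Fin d → invLattice.Term (Fin n))
    (t : Fin m → Fin n → invLattice.Term (Fin d × Fin d)),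
    ∀ u : Fin n → Submodule F V, u ∈ thetaAlpha B (1 : Fin d → F) (matrixSet F ψ) →
      ∃ k, IsAlphaFrame B (1 : Fin d → F) (fun i j => latticeEval B (a k i j) u) ∧
        ∀ l, u l = latticeEval B (t k l) (fun p => latticeEval B (a k p.1 p.2) u)

end

/-! Two orthonormal bases differ by a similarity of the form, and a similarity commutes with joins
and orthogonal complements, hence with every lattice term. So the subspaces `t^k` evaluated at an
orthonormal frame have the same coordinate matrices in every orthonormal basis
(`latticeEval_basisFrame_mem_thetaBasis`). Call `k` good if these matrices can be chosen in `K`;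
this does not depend on `u`.

The formula is the disjunction over the good `k` of "`a^k(u)` is an orthonormal frame and `u =
t^k(a^k(u))`". If it holds, goodness transfers to the frame at hand and puts `u` in the set.
Conversely, the hidden coordinate systems supply `k` and a frame, and bi-invariance moves the
coordinates of `u` to the basis of that frame (`thetaBasis_subset_of_isBiInvariant`), so `k` is
good.

Being an orthonormal frame is quantifier-free by `isAlphaFrame_iff_frameConditions`, where `3 ≤ d`
lets equality of norms be expressed through a third basis vector. -/

/-! ### Similarities and changes of orthonormal basis -/

section Similarity

variable {F V : Type*} [Field F] [StarRing F] [AddCommGroup V] [Module F V]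
  {B : V →ₗ⋆[F] V →ₗ[F] F}

/-- Similarities of the form commute with orthogonal complements. -/
theorem map_orthogonalBilin_of_similarity (g : V ≃ₗ[F] V) {r : F} (hr : r ≠ 0)
    (hg : ∀ x y, B (g x) (g y) = r * B x y) (U : Submodule F V) :
    (U.orthogonalBilin B).map g.toLinearMap = (U.map g.toLinearMap).orthogonalBilin B := by
  ext x
  obtain ⟨y, rfl⟩ := g.surjective x
  have hy : g y ∈ (U.orthogonalBilin B).map g.toLinearMap ↔ y ∈ U.orthogonalBilin B :=
    (Submodule.mem_map_equiv _).trans (by simp)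
  rw [hy]
  simp only [Submodule.mem_orthogonalBilin_iff, Submodule.mem_map, forall_exists_index, and_imp,
    forall_apply_eq_imp_iff₂, LinearEquiv.coe_coe, hg, mul_eq_zero, hr, false_or]

/-- Similarities of the form commute with lattice terms. -/
theorem latticeEval_map_of_similarity (g : V ≃ₗ[F] V) {r : F} (hr : r ≠ 0)
    (hg : ∀ x y, B (g x) (g y) = r * B x y) {ι : Type*} (t : invLattice.Term ι)
    (u : ι → Submodule F V) :
    latticeEval B t (fun i => (u i).map g.toLinearMap) =
      (latticeEval B t u).map g.toLinearMap := by
  induction t with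
  | var i => rfl
  | func f ts ih =>
    cases f with
    | zero => exact (Submodule.map_bot _).symm
    | perp =>
      change (latticeEval B (ts 0) _).orthogonalBilin B =
        ((latticeEval B (ts 0) u).orthogonalBilin B).map _
      rw [ih, map_orthogonalBilin_of_similarity g hr hg]
    | join =>
      change latticeEval B (ts 0) _ ⊔ latticeEval B (ts 1) _ =
        (latticeEval B (ts 0) u ⊔ latticeEval B (ts 1) u).map _
      rw [ih, ih, Submodule.map_sup]

omit [StarRing F] in
theorem map_columnSpan {d : ℕ} (v w : Module.Basis (Fin d) F V) (A : Matrix (Fin d) (Fin d) F) :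
    (columnSpan v A).map (v.equiv w (Equiv.refl _)).toLinearMap = columnSpan w A := by
  simp only [columnSpan, Submodule.map_span, ← Set.range_comp]
  congr 2
  ext j
  simp

omit [StarRing F] in
theorem map_basisFrame {d : ℕ} (v w : Module.Basis (Fin d) F V) (i j : Fin d) :
    (basisFrame v i j).map (v.equiv w (Equiv.refl _)).toLinearMap = basisFrame w i j := by
  unfold basisFrame
  split_ifs <;> simp [Submodule.map_span]

variable {d : ℕ} [NeZero d]

/-- Since `0⁻¹ = 0`, an isotropic first vector would make the first form constant `0` instead of
`1`. -/
theorem IsAlphaBasis.norm_ne_zero {v : Module.Basis (Fin d) F V}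
    (hv : IsAlphaBasis B (1 : Fin d → F) v) : B (v 0) (v 0) ≠ 0 := by
  intro h
  have := congrFun hv.2 0
  simp [formConstants, h] at this

theorem IsAlphaBasis.apply_basis {v : Module.Basis (Fin d) F V}
    (hv : IsAlphaBasis B (1 : Fin d → F) v) (i j : Fin d) :
    B (v i) (v j) = if i = j then B (v 0) (v 0) else 0 := by
  split_ifs with h
  · subst h
    have := congrFun hv.2 i
    have h0 := hv.norm_ne_zero
    simp only [formConstants, Pi.one_apply] at this
    field_simp at this
    exact this
  · exact hv.1 i j h

theorem isAlphaBasis_one_of_norm_eq {v : Module.Basis (Fin d) F V} (h0 : B (v 0) (v 0) ≠ 0)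
    (horth : ∀ i j, i ≠ j → B (v i) (v j) = 0) (hnorm : ∀ i, B (v i) (v i) = B (v 0) (v 0)) :
    IsAlphaBasis B (1 : Fin d → F) v :=
  ⟨horth, funext fun i => by simp [formConstants, hnorm i, h0]⟩

/-- In an orthonormal basis the form is, up to scaling, the standard one. -/
theorem IsAlphaBasis.apply_eq_sum {v : Module.Basis (Fin d) F V}
    (hv : IsAlphaBasis B (1 : Fin d → F) v) (x y : Fin d → F) :
    B (∑ i, x i • v i) (∑ i, y i • v i) = (∑ i, star (x i) * y i) * B (v 0) (v 0) := by
  have hb := hv.apply_basis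
  generalize B (v 0) (v 0) = N at hb ⊢
  simp only [map_sum, LinearMap.sum_apply, map_smulₛₗ, LinearMap.smul_apply, RingHom.id_apply,
    hb, smul_eq_mul, Finset.sum_mul, mul_ite, mul_zero, Finset.sum_ite_eq',
    Finset.mem_univ, if_true, starRingEnd_apply]
  exact Finset.sum_congr rfl fun i _ => by ring

/-- The linear map carrying one orthonormal basis to another is a similarity. -/
theorem IsAlphaBasis.equiv_similarity {v w : Module.Basis (Fin d) F V}
    (hv : IsAlphaBasis B (1 : Fin d → F) v) (hw : IsAlphaBasis B (1 : Fin d → F) w) (x y : V) :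
    B (v.equiv w (Equiv.refl _) x) (v.equiv w (Equiv.refl _) y) =
      (B (w 0) (w 0) * (B (v 0) (v 0))⁻¹) * B x y := by
  have h0 := hv.norm_ne_zero
  have he (z : V) : v.equiv w (Equiv.refl _) z = ∑ i, v.repr z i • w i := by
    conv_lhs => rw [← v.sum_repr z]
    simp only [map_sum, map_smul, Module.Basis.equiv_apply, Equiv.refl_apply]
  conv_rhs => rw [← v.sum_repr x, ← v.sum_repr y]
  rw [he, he, hv.apply_eq_sum, hw.apply_eq_sum]
  field_simp

/-- The value of a tuple of terms at the frame of an orthonormal basis has, in the coordinates given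
by that basis, a description not depending on the basis. -/
theorem latticeEval_basisFrame_mem_thetaBasis {v w : Module.Basis (Fin d) F V}
    (hv : IsAlphaBasis B (1 : Fin d → F) v) (hw : IsAlphaBasis B (1 : Fin d → F) w) {n : ℕ}
    (t : Fin n → invLattice.Term (Fin d × Fin d)) {K : Set (Fin n → Matrix (Fin d) (Fin d) F)}
    (h : (fun l => latticeEval B (t l) fun p => basisFrame v p.1 p.2) ∈ thetaBasis v K) :
    (fun l => latticeEval B (t l) fun p => basisFrame w p.1 p.2) ∈ thetaBasis w K := by
  obtain ⟨A, hA, hu⟩ := h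
  refine ⟨A, hA, fun l => ?_⟩
  have hr : B (w 0) (w 0) * (B (v 0) (v 0))⁻¹ ≠ 0 :=
    mul_ne_zero hw.norm_ne_zero (inv_ne_zero hv.norm_ne_zero)
  rw [← map_columnSpan v w, ← hu l, ← latticeEval_map_of_similarity _ hr (hv.equiv_similarity hw)]
  simp only [map_basisFrame]

/-- If `K` is bi-invariant then membership in `θ_{F v L}(K)` does not depend on the choice of the
orthonormal basis `v`. -/
theorem thetaBasis_subset_of_isBiInvariant (hB : ∀ v w, B w v = star (B v w))
    {v w : Module.Basis (Fin d) F V}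
    (hv : IsAlphaBasis B (1 : Fin d → F) v) (hw : IsAlphaBasis B (1 : Fin d → F) w) {n : ℕ}
    {K : Set (Fin n → Matrix (Fin d) (Fin d) F)} (hK : IsBiInvariant (1 : Fin d → F) K) :
    thetaBasis v K ⊆ thetaBasis w K := by
  rintro u ⟨A, hA, hu⟩
  -- `T` expresses `v` in terms of `w`, so coordinates `A` with respect to `v` become `T * A` with
  -- respect to `w`.
  let T : Matrix.GeneralLinearGroup (Fin d) F :=
    ⟨w.toMatrix v, v.toMatrix w, w.toMatrix_mul_toMatrix_flip v, v.toMatrix_mul_toMatrix_flip w⟩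
  have hexp : ∀ j, v j = ∑ i, w.toMatrix v i j • w i := fun j => (w.sum_toMatrix_smul_self v j).symm
  have hv0 := hv.norm_ne_zero
  have hw0 := hw.norm_ne_zero
  have hT : IsScaledOrthogonal (1 : Fin d → F) T := by
    -- The factor is the ratio of the two common norms: comparing Gram matrices gives `T^* T = r •
    -- 1`. Hermiticity makes `r` symmetric.
    refine ⟨B (v 0) (v 0) * (B (w 0) (w 0))⁻¹, mul_ne_zero hv0 (inv_ne_zero hw0), ?_, ?_⟩
    · rw [star_mul', star_inv₀, ← hB, ← hB]
    · have hmul : (w.toMatrix v).conjTranspose * w.toMatrix v =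
          (B (v 0) (v 0) * (B (w 0) (w 0))⁻¹) • (1 : Matrix (Fin d) (Fin d) F) := by
        ext i j
        have h := hv.apply_basis i j
        rw [hexp i, hexp j, hw.apply_eq_sum] at h
        rw [Matrix.mul_apply, Matrix.smul_apply, Matrix.one_apply]
        simp only [Matrix.conjTranspose_apply]
        rw [(eq_mul_inv_iff_mul_eq₀ hw0).2 h]
        split_ifs <;> simp
      have : alphaAdjoint (1 : Fin d → F) (T : Matrix (Fin d) (Fin d) F) =
          (w.toMatrix v).conjTranspose := by
        simp [alphaAdjoint, T]
      rw [this]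
      change _ = _ • v.toMatrix w
      calc (w.toMatrix v).conjTranspose
          = (w.toMatrix v).conjTranspose * (w.toMatrix v * v.toMatrix w) := by
            rw [w.toMatrix_mul_toMatrix_flip v, mul_one]
        _ = _ := by rw [← mul_assoc, hmul, smul_mul_assoc, one_mul]
  refine ⟨_, hK A hA T hT 1, fun k => ?_⟩
  rw [hu k]
  unfold columnSpan
  congr 2
  ext j
  simp only [Pi.one_apply, Units.val_one, mul_one]
  simp only [Matrix.mul_apply, Finset.sum_smul]
  rw [Finset.sum_comm]
  refine Finset.sum_congr rfl fun i _ => ?_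
  conv_lhs => rw [hexp i, Finset.smul_sum]
  exact Finset.sum_congr rfl fun l _ => by rw [smul_smul, mul_comm]

end Similarity

/-! ### Closure properties of terms and quantifier-free properties -/

section Definability

variable {F V : Type*} [Field F] [StarRing F] [AddCommGroup V] [Module F V]
  (B : V →ₗ⋆[F] V →ₗ[F] F) {ι : Type*}

/-- Functions on tuples of subspaces given by lattice terms. -/
def IsTermFunction (f : (ι → Submodule F V) → Submodule F V) : Prop :=
  ∃ t : invLattice.Term ι, ∀ u, latticeEval B t u = f u

/-- Properties of tuples of subspaces given by quantifier-free lattice formulas. -/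
def IsQFProperty (P : (ι → Submodule F V) → Prop) : Prop :=
  ∃ φ : invLattice.Formula ι, φ.IsQF ∧ ∀ u, P u ↔ LatticeHolds B φ u

variable {B} {f g : (ι → Submodule F V) → Submodule F V} {P Q : (ι → Submodule F V) → Prop}

theorem IsTermFunction.bot : IsTermFunction B fun _ : ι → Submodule F V => ⊥ :=
  ⟨.func InvLatticeFunc.zero ![], fun _ => rfl⟩

theorem IsTermFunction.perp (hf : IsTermFunction B f) :
    IsTermFunction B fun u => (f u).orthogonalBilin B := by
  obtain ⟨t, ht⟩ := hf
  exact ⟨.func InvLatticeFunc.perp ![t], fun u =>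
    congrArg (fun U : Submodule F V => U.orthogonalBilin B) (ht u)⟩

theorem IsTermFunction.sup (hf : IsTermFunction B f) (hg : IsTermFunction B g) :
    IsTermFunction B fun u => f u ⊔ g u := by
  obtain ⟨t, ht⟩ := hf
  obtain ⟨s, hs⟩ := hg
  exact ⟨.func InvLatticeFunc.join ![t, s], fun u => congrArg₂ (· ⊔ ·) (ht u) (hs u)⟩

theorem IsTermFunction.top : IsTermFunction B fun _ : ι → Submodule F V => ⊤ := by
  have h : (⊥ : Submodule F V).orthogonalBilin B = ⊤ := by
    ext x
    simp [Submodule.mem_orthogonalBilin_iff]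
  simpa only [h] using (IsTermFunction.bot (B := B) (ι := ι)).perp

theorem IsTermFunction.iSup {κ : Type*} [Fintype κ]
    {f : κ → (ι → Submodule F V) → Submodule F V} (hf : ∀ k, IsTermFunction B (f k)) :
    IsTermFunction B fun u => ⨆ k, f k u := by
  classical
  simp only [← Finset.sup_univ_eq_iSup]
  induction (Finset.univ : Finset κ) using Finset.induction_on with
  | empty => simpa using IsTermFunction.bot
  | insert k s _ ih => simpa only [Finset.sup_insert] using (hf k).sup ih

theorem IsQFProperty.eq (hf : IsTermFunction B f) (hg : IsTermFunction B g) :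
    IsQFProperty B fun u => f u = g u := by
  obtain ⟨t, ht⟩ := hf
  obtain ⟨s, hs⟩ := hg
  refine ⟨t.equal s, (Language.BoundedFormula.IsAtomic.equal _ _).isQF, fun u => ?_⟩
  let _ := subspaceStructure B
  beta_reduce
  rw [← ht, ← hs]
  exact (Language.Formula.realize_equal (t₁ := t) (t₂ := s) (x := u)).symm

theorem IsQFProperty.le (hf : IsTermFunction B f) (hg : IsTermFunction B g) :
    IsQFProperty B fun u => f u ≤ g u := by
  simpa only [sup_eq_right] using IsQFProperty.eq (hf.sup hg) hg

theorem IsQFProperty.not (hP : IsQFProperty B P) : IsQFProperty B fun u => ¬ P u := by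
  obtain ⟨φ, hφ, h⟩ := hP
  refine ⟨φ.not, hφ.not, fun u => ?_⟩
  exact not_congr (h u)

theorem IsQFProperty.and (hP : IsQFProperty B P) (hQ : IsQFProperty B Q) :
    IsQFProperty B fun u => P u ∧ Q u := by
  obtain ⟨φ, hφ, h⟩ := hP
  obtain ⟨χ, hχ, h'⟩ := hQ
  refine ⟨φ ⊓ χ, hφ.inf hχ, fun u => ?_⟩
  let _ := subspaceStructure B
  exact (and_congr (h u) (h' u)).trans Language.Formula.realize_inf.symm

theorem IsQFProperty.true : IsQFProperty B fun _ : ι → Submodule F V => True := by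
  simpa using IsQFProperty.eq (IsTermFunction.bot (B := B) (ι := ι)) .bot

/-- A condition independent of `u` is decided outside the language: it only determines which formula
is taken. -/
theorem IsQFProperty.const_imp {c : Prop} (hP : c → IsQFProperty B P) :
    IsQFProperty B fun u => c → P u := by
  by_cases hc : c
  · simpa [hc] using hP hc
  · simpa [hc] using IsQFProperty.true

theorem IsQFProperty.forall {κ : Type*} [Fintype κ] {P : κ → (ι → Submodule F V) → Prop}
    (hP : ∀ k, IsQFProperty B (P k)) : IsQFProperty B fun u => ∀ k, P k u := by
  classical
  suffices h : ∀ s : Finset κ, IsQFProperty B fun u => ∀ k ∈ s, P k u by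
    simpa using h Finset.univ
  intro s
  induction s using Finset.induction_on with
  | empty => simpa using IsQFProperty.true
  | insert k s _ ih => simpa only [Finset.forall_mem_insert] using (hP k).and ih

theorem IsQFProperty.exists {κ : Type*} [Fintype κ] {P : κ → (ι → Submodule F V) → Prop}
    (hP : ∀ k, IsQFProperty B (P k)) : IsQFProperty B fun u => ∃ k, P k u := by
  simpa only [not_forall, not_not] using (IsQFProperty.forall fun k => (hP k).not).not

theorem IsTermFunction.comp {κ : Type*} {f : (κ → Submodule F V) → Submodule F V}
    (hf : IsTermFunction B f) {g : κ → (ι → Submodule F V) → Submodule F V}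
    (hg : ∀ k, IsTermFunction B (g k)) : IsTermFunction B fun u => f fun k => g k u := by
  obtain ⟨t, ht⟩ := hf
  choose s hs using hg
  refine ⟨t.subst s, fun u => ?_⟩
  let _ := subspaceStructure B
  beta_reduce
  rw [← ht]
  simp only [← hs]
  exact Language.Term.realize_subst

end Definability

/-! ### Lattice conditions for orthonormal frames -/

section Frames

variable {F V : Type*} [Field F] [StarRing F] [AddCommGroup V] [Module F V]
  {d : ℕ} [NeZero d]

/-- Lattice conditions, free of quantifiers over subspaces, that characterize orthonormal frames:
the diagonal is an orthogonal decomposition into nonzero summands, `a 0 i` is the graph of an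
isomorphism between `a 0 0` and `a i i`, the other entries are determined by these, and the last
condition says that the isomorphisms are isometries. -/
def FrameConditions (B : V →ₗ⋆[F] V →ₗ[F] F) (a : Fin d → Fin d → Submodule F V) : Prop :=
  (∀ i j, i ≠ j → a i i ≤ (a j j).orthogonalBilin B) ∧
  (∀ i, a i i ≠ ⊥) ∧
  (⨆ i, a i i) = ⊤ ∧
  (∀ i, i ≠ 0 → a 0 i ⊔ a 0 0 = a 0 0 ⊔ a i i ∧ a 0 i ⊔ a i i = a 0 0 ⊔ a i i ∧
    a 0 i ≠ a 0 0 ⊔ a i i ∧ a i 0 = a 0 i) ∧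
  (∀ i j, i ≠ 0 → j ≠ 0 → i ≠ j →
    a i j ≠ ⊥ ∧ a i j ≤ a 0 i ⊔ a 0 j ∧ a i j ≤ a i i ⊔ a j j ∧
    a 0 i ≤ (a 0 0 ⊔ a i j).orthogonalBilin B ⊔ (a i i ⊔ a 0 j).orthogonalBilin B)

theorem isQFProperty_frameConditions (B : V →ₗ⋆[F] V →ₗ[F] F) {ι : Type*}
    {a : Fin d → Fin d → (ι → Submodule F V) → Submodule F V}
    (ha : ∀ i j, IsTermFunction B (a i j)) :
    IsQFProperty B fun u => FrameConditions B fun i j => a i j u := by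
  refine .and (.forall fun i => .forall fun j => .const_imp fun _ => .le (ha i i) (ha j j).perp)
    (.and (.forall fun i => .not (.eq (ha i i) .bot))
    (.and (.eq (.iSup fun i => ha i i) .top)
    (.and (.forall fun i => .const_imp fun _ => ?_)
      (.forall fun i => .forall fun j => .const_imp fun _ => .const_imp fun _ =>
        .const_imp fun _ => ?_))))
  · exact .and (.eq (.sup (ha 0 i) (ha 0 0)) (.sup (ha 0 0) (ha i i)))
      (.and (.eq (.sup (ha 0 i) (ha i i)) (.sup (ha 0 0) (ha i i)))
      (.and (.not (.eq (ha 0 i) (.sup (ha 0 0) (ha i i)))) (.eq (ha i 0) (ha 0 i))))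
  · exact .and (.not (.eq (ha i j) .bot)) (.and (.le (ha i j) (.sup (ha 0 i) (ha 0 j)))
      (.and (.le (ha i j) (.sup (ha i i) (ha j j)))
      (.le (ha 0 i) (.sup (.perp (.sup (ha 0 0) (ha i j))) (.perp (.sup (ha i i) (ha 0 j)))))))

end Frames

/-! ### The conditions characterize orthonormal frames -/

section FrameCharacterization

variable {F V : Type*} [Field F] [StarRing F] [AddCommGroup V] [Module F V]
  {d : ℕ} [NeZero d] {B : V →ₗ⋆[F] V →ₗ[F] F}

/-- The frame of an orthonormal basis satisfies the frame conditions. -/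
theorem frameConditions_basisFrame {v : Module.Basis (Fin d) F V}
    (hv : IsAlphaBasis B (1 : Fin d → F) v) : FrameConditions B (basisFrame v) := by
  have hdiag (i) : basisFrame v i i = Submodule.span F {v i} := by simp [basisFrame]
  have hoff {i j} (h : i ≠ j) : basisFrame v i j = Submodule.span F {v j - v i} := by
    simp [basisFrame, h]
  have hne {i j : Fin d} (h : i ≠ j) : v j - v i ≠ 0 :=
    sub_ne_zero.2 (v.injective.ne h.symm)
  have hb := hv.apply_basis
  generalize B (v 0) (v 0) = N at hb
  refine ⟨fun i j h => ?_, fun i => ?_, ?_, fun i hi => ?_, fun i j hi hj hij => ?_⟩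
  · rw [hdiag, hdiag, Submodule.span_singleton_le_iff_mem, Submodule.mem_orthogonalBilin_iff]
    intro x hx
    obtain ⟨c, rfl⟩ := Submodule.mem_span_singleton.1 hx
    simp [hv.1 j i h.symm]
  · simpa [hdiag] using v.ne_zero i
  · simp only [hdiag]
    rw [← Submodule.span_iUnion, Set.iUnion_singleton_eq_range, v.span_eq]
  · rw [hoff hi.symm, hoff hi, hdiag, hdiag]
    have h0 : v 0 ∈ Submodule.span F {v 0} := Submodule.mem_span_singleton_self _
    have h1 : v i ∈ Submodule.span F {v i} := Submodule.mem_span_singleton_self _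
    have h2 : v i - v 0 ∈ Submodule.span F {v i - v 0} := Submodule.mem_span_singleton_self _
    have hle : Submodule.span F {v i - v 0} ≤ Submodule.span F {v 0} ⊔ Submodule.span F {v i} :=
      (Submodule.span_singleton_le_iff_mem _ _).2
        (Submodule.sub_mem _ (Submodule.mem_sup_right h1) (Submodule.mem_sup_left h0))
    refine ⟨le_antisymm (sup_le hle le_sup_left) (sup_le le_sup_right ?_),
      le_antisymm (sup_le hle le_sup_right) (sup_le ?_ le_sup_right), ?_, ?_⟩
    · rw [Submodule.span_singleton_le_iff_mem]
      simpa using add_mem (Submodule.mem_sup_left (T := Submodule.span F {v 0}) h2)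
        (Submodule.mem_sup_right h0)
    · rw [Submodule.span_singleton_le_iff_mem]
      simpa using sub_mem (Submodule.mem_sup_right (S := Submodule.span F {v i - v 0}) h1)
        (Submodule.mem_sup_left h2)
    · intro h
      have : v 0 ∈ Submodule.span F {v i - v 0} := h ▸ Submodule.mem_sup_left h0
      obtain ⟨c, hc⟩ := Submodule.mem_span_singleton.1 this
      have e0 := congrArg (fun x => v.repr x 0) hc
      have e1 := congrArg (fun x => v.repr x i) hc
      simp [hi, hi.symm] at e0 e1
      simp [e1] at e0
    · rw [← neg_sub, ← Set.neg_singleton, Submodule.span_neg]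
  · rw [hoff hij, hoff hi.symm, hoff hj.symm, hdiag, hdiag, hdiag]
    refine ⟨by simpa using hne hij, ?_, ?_, ?_⟩
    · rw [Submodule.span_singleton_le_iff_mem]
      have := sub_mem (Submodule.mem_sup_right (S := Submodule.span F {v i - v 0})
        (Submodule.mem_span_singleton_self (v j - v 0)))
        (Submodule.mem_sup_left (Submodule.mem_span_singleton_self (v i - v 0)))
      simpa using this
    · rw [Submodule.span_singleton_le_iff_mem]
      exact sub_mem (Submodule.mem_sup_right (Submodule.mem_span_singleton_self _))
        (Submodule.mem_sup_left (Submodule.mem_span_singleton_self _))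
    · rw [Submodule.span_singleton_le_iff_mem]
      -- The decomposition is `v i - v 0 = (v i + v j) - (v 0 + v j)`. A sum of two orthogonal
      -- vectors of equal norm is orthogonal to their difference.
      have hx : v i + v j ∈
          (Submodule.span F {v 0} ⊔ Submodule.span F {v j - v i}).orthogonalBilin B := by
        rw [Submodule.mem_orthogonalBilin_iff]
        intro x hx
        obtain ⟨y, hy, z, hz, rfl⟩ := Submodule.mem_sup.1 hx
        obtain ⟨c, rfl⟩ := Submodule.mem_span_singleton.1 hy
        obtain ⟨e, rfl⟩ := Submodule.mem_span_singleton.1 hz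
        simp [hb, hi.symm, hj.symm, hij, hij.symm]
      have hy : v 0 + v j ∈
          (Submodule.span F {v i} ⊔ Submodule.span F {v j - v 0}).orthogonalBilin B := by
        rw [Submodule.mem_orthogonalBilin_iff]
        intro x hx
        obtain ⟨y, hy, z, hz, rfl⟩ := Submodule.mem_sup.1 hx
        obtain ⟨c, rfl⟩ := Submodule.mem_span_singleton.1 hy
        obtain ⟨e, rfl⟩ := Submodule.mem_span_singleton.1 hz
        simp [hb, hi, hj, hj.symm, hij]
      simpa using sub_mem (Submodule.mem_sup_left (T :=
        (Submodule.span F {v i} ⊔ Submodule.span F {v j - v 0}).orthogonalBilin B) hx)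
        (Submodule.mem_sup_right hy)

/-- Nonzero pairwise orthogonal subspaces, as many as the dimension, that span the space are the
lines of an orthogonal basis. -/
theorem exists_basis_of_orthogonal (hB : IsInnerProductForm B) (hdim : Module.finrank F V = d)
    {a : Fin d → Submodule F V} (horth : ∀ i j, i ≠ j → a i ≤ (a j).orthogonalBilin B)
    (hne : ∀ i, a i ≠ ⊥) (htop : ⨆ i, a i = ⊤) :
    ∃ w : Module.Basis (Fin d) F V, IsOrthogonalBasis B w ∧ (∀ i, B (w i) (w i) ≠ 0) ∧
      ∀ i, a i = Submodule.span F {w i} := by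
  have hzero {i j} (h : i ≠ j) {x y : V} (hx : x ∈ a i) (hy : y ∈ a j) : B x y = 0 :=
    Submodule.mem_orthogonalBilin_iff.1 (horth j i h.symm hy) x hx
  have hnd {x : V} (hx : ∀ j, ∀ y ∈ a j, B y x = 0) : x = 0 := by
    refine hB.nondegenerate x fun y => ?_
    have hy : y ∈ ⨆ i, a i := htop ▸ Submodule.mem_top
    induction hy using Submodule.iSup_induction' with
    | mem i y hy => exact hx i y hy
    | zero => simp
    | add y z _ _ hy hz => simp [hy, hz]
  choose w hwa hw0 using fun i => Submodule.exists_mem_ne_zero_of_ne_bot (hne i)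
  -- At this point `a i` might have larger dimension and `w i` might be isotropic, so the nonzero
  -- pairing is sought with some other `y ∈ a i`.
  have hself (i) : ∃ y ∈ a i, B y (w i) ≠ 0 := by
    by_contra! h
    refine hw0 i (hnd fun j y hy => ?_)
    by_cases hij : j = i
    · subst hij; exact h y hy
    · exact hzero hij hy (hwa i)
  have hli : LinearIndependent F w := by
    rw [Fintype.linearIndependent_iff]
    intro c hc i
    obtain ⟨y, hy, hyw⟩ := hself i
    have := congrArg (B y) hc
    rw [map_sum, Finset.sum_eq_single i] at this
    · simpa [hyw] using this
    · intro j _ hj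
      simp [hzero hj.symm hy (hwa j)]
    · simp
  let b := basisOfLinearIndependentOfCardEqFinrank hli (by simp [hdim])
  have hb (i) : b i = w i := by simp [b]
  have hbo (i j) (h : i ≠ j) : B (b i) (b j) = 0 := by
    rw [hb, hb]; exact hzero h (hwa i) (hwa j)
  have hexp (x y : V) : B x y = ∑ j, b.repr y j * B x (b j) := by
    conv_lhs => rw [← b.sum_repr y]
    simp only [map_sum, map_smul, smul_eq_mul]
  have hbn (i) : B (b i) (b i) ≠ 0 := by
    intro h
    refine b.ne_zero i (hB.nondegenerate _ fun y => ?_)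
    rw [hB.hermitian (b i) y, hexp, Finset.sum_eq_zero, star_zero]
    intro j _
    by_cases hij : i = j
    · subst hij; simp [h]
    · simp [hbo i j hij]
  refine ⟨b, hbo, hbn, fun i => le_antisymm (fun x hx => ?_) ?_⟩
  · rw [Submodule.mem_span_singleton]
    refine ⟨b.repr x i, ?_⟩
    conv_rhs => rw [← b.sum_repr x]
    rw [Finset.sum_eq_single i _ (by simp)]
    intro j _ hj
    have h : B (b j) x = 0 := by rw [hb]; exact hzero hj (hwa j) hx
    rw [hexp, Finset.sum_eq_single j (fun k _ hk => by simp [hbo j k hk.symm]) (by simp)] at h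
    simp [(mul_eq_zero.1 h).resolve_right (hbn j)]
  · rw [Submodule.span_singleton_le_iff_mem, hb]
    exact hwa i

omit [StarRing F] in
/-- A common complement of two lines in their sum is spanned by the difference of the first
spanning vector and a suitable multiple of the second. -/
theorem exists_smul_sub_span_of_common_complement {x y : V} {U : Submodule F V}
    (hx : U ⊔ Submodule.span F {x} = Submodule.span F {x} ⊔ Submodule.span F {y})
    (hy : U ⊔ Submodule.span F {y} = Submodule.span F {x} ⊔ Submodule.span F {y})
    (hU : U ≠ Submodule.span F {x} ⊔ Submodule.span F {y}) :
    ∃ c : F, c ≠ 0 ∧ U = Submodule.span F {c • y - x} := by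
  have hxU : x ∉ U := fun h => hU <| by
    rw [← hx, sup_eq_left.2 ((Submodule.span_singleton_le_iff_mem _ _).2 h)]
  have hyU : y ∉ U := fun h => hU <| by
    rw [← hy, sup_eq_left.2 ((Submodule.span_singleton_le_iff_mem _ _).2 h)]
  have hmem : y ∈ U ⊔ Submodule.span F {x} :=
    hx ▸ Submodule.mem_sup_right (Submodule.mem_span_singleton_self y)
  obtain ⟨p, hp, q, hq, hpq⟩ := Submodule.mem_sup.1 hmem
  obtain ⟨c, rfl⟩ := Submodule.mem_span_singleton.1 hq
  have hc : c ≠ 0 := by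
    rintro rfl
    rw [zero_smul, add_zero] at hpq
    exact hyU (hpq ▸ hp)
  have hcp : c⁻¹ • y - x ∈ U := by
    have : c⁻¹ • y - x = c⁻¹ • p := by
      rw [← hpq, smul_add, smul_smul, inv_mul_cancel₀ hc, one_smul, add_sub_cancel_right]
    exact this ▸ U.smul_mem _ hp
  refine ⟨c⁻¹, inv_ne_zero hc, le_antisymm (fun z hz => ?_)
    ((Submodule.span_singleton_le_iff_mem _ _).2 hcp)⟩
  have hz' : z ∈ Submodule.span F {x} ⊔ Submodule.span F {y} :=
    hx ▸ Submodule.mem_sup_left hz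
  obtain ⟨p', hp', q', hq', rfl⟩ := Submodule.mem_sup.1 hz'
  obtain ⟨s, rfl⟩ := Submodule.mem_span_singleton.1 hp'
  obtain ⟨t, rfl⟩ := Submodule.mem_span_singleton.1 hq'
  have hdiff : (s + t * c) • x ∈ U := by
    have : (s + t * c) • x = (s • x + t • y) - (t * c) • (c⁻¹ • y - x) := by
      rw [smul_sub, smul_smul, mul_assoc, mul_inv_cancel₀ hc, mul_one, add_smul]
      abel
    exact this ▸ U.sub_mem hz (U.smul_mem _ hcp)
  have hst : s + t * c = 0 := by
    by_contra h
    exact hxU ((U.smul_mem_iff h).1 hdiff)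
  refine Submodule.mem_span_singleton.2 ⟨t * c, ?_⟩
  rw [smul_sub, smul_smul, mul_assoc, mul_inv_cancel₀ hc, mul_one, eq_neg_of_add_eq_zero_left hst,
    neg_smul]
  abel

/-- For the converse, the diagonal gives an orthogonal basis up to scalars, the entries `a 0 i` fix
the scalars relative to the first vector, and the last condition forces equal norms. -/
theorem isAlphaFrame_iff_frameConditions (hB : IsInnerProductForm B) (hd : 3 ≤ d)
    (hdim : Module.finrank F V = d) (a : Fin d → Fin d → Submodule F V) :
    IsAlphaFrame B (1 : Fin d → F) a ↔ FrameConditions B a := by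
  constructor
  · rintro ⟨v, hv, ha⟩
    obtain rfl : a = basisFrame v := funext₂ ha
    exact frameConditions_basisFrame hv
  rintro ⟨horth, hne, htop, haxis, hcomp⟩
  obtain ⟨w, hwo, hwn, hwa⟩ := exists_basis_of_orthogonal hB hdim horth hne htop
  have hscale (i : Fin d) :
      ∃ c : F, c ≠ 0 ∧ (i = 0 → c = 1) ∧ (i ≠ 0 → a 0 i = Submodule.span F {c • w i - w 0}) := by
    by_cases hi : i = 0
    · exact ⟨1, one_ne_zero, fun _ => rfl, fun h => absurd hi h⟩
    · obtain ⟨h1, h2, h3, -⟩ := haxis i hi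
      rw [hwa 0, hwa i] at h1 h2 h3
      obtain ⟨c, hc, h⟩ := exists_smul_sub_span_of_common_complement h1 h2 h3
      exact ⟨c, hc, fun h => absurd h hi, fun _ => h⟩
  choose c hc hc0 hca using hscale
  let v := w.isUnitSMul fun i => (hc i).isUnit
  have hvw (i) : v i = c i • w i := by simp [v, Module.Basis.isUnitSMul_apply]
  have hdiag (i) : a i i = Submodule.span F {v i} := by
    rw [hwa, hvw, Submodule.span_singleton_smul_eq (hc i).isUnit]
  have haxis' {i} (hi : i ≠ 0) : a 0 i = Submodule.span F {v i - v 0} := by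
    rw [hca i hi, hvw, hvw 0, hc0 0 rfl, one_smul]
  have hvo (i j) (h : i ≠ j) : B (v i) (v j) = 0 := by simp [hvw, hwo i j h]
  have hoff {i j} (hi : i ≠ 0) (hj : j ≠ 0) (hij : i ≠ j) :
      a i j = Submodule.span F {v j - v i} := by
    obtain ⟨hbot, h1, h2, -⟩ := hcomp i j hi hj hij
    -- The planes spanned by `v i - v 0, v j - v 0` and by `v i, v j` meet in this line: the
    -- coordinate at `v 0` must vanish.
    have hle : a i j ≤ Submodule.span F {v j - v i} := by
      intro x hx
      have hx1 := h1 hx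
      have hx2 := h2 hx
      rw [haxis' hi, haxis' hj] at hx1
      rw [hdiag, hdiag] at hx2
      obtain ⟨_, hp, _, hq, rfl⟩ := Submodule.mem_sup.1 hx1
      obtain ⟨s, rfl⟩ := Submodule.mem_span_singleton.1 hp
      obtain ⟨t, rfl⟩ := Submodule.mem_span_singleton.1 hq
      obtain ⟨_, hp', _, hq', heq⟩ := Submodule.mem_sup.1 hx2
      obtain ⟨s', rfl⟩ := Submodule.mem_span_singleton.1 hp'
      obtain ⟨t', rfl⟩ := Submodule.mem_span_singleton.1 hq'
      have e := congrArg (fun x => v.repr x 0) heq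
      simp [hi.symm, hj.symm] at e
      have hst : s = -t := by linear_combination e
      refine Submodule.mem_span_singleton.2 ⟨t, ?_⟩
      rw [hst]
      module
    obtain ⟨x, hx, hx0⟩ := Submodule.exists_mem_ne_zero_of_ne_bot hbot
    refine le_antisymm hle ((Submodule.span_singleton_le_iff_mem _ _).2 ?_)
    obtain ⟨s, rfl⟩ := Submodule.mem_span_singleton.1 (hle hx)
    exact ((a i j).smul_mem_iff fun hs => hx0 (by rw [hs, zero_smul])).1 hx
  have hnorm (i) : B (v i) (v i) = B (v 0) (v 0) := by
    by_cases hi : i = 0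
    · rw [hi]
    -- A third index exists because `3 ≤ d`.
    obtain ⟨k, hk⟩ : ∃ k : Fin d, k ∉ ({0, i} : Finset (Fin d)) := by
      by_contra! h
      have h1 : (Finset.univ : Finset (Fin d)).card ≤ ({0, i} : Finset (Fin d)).card :=
        Finset.card_le_card fun x _ => h x
      have h2 := Finset.card_le_two (a := (0 : Fin d)) (b := i)
      rw [Finset.card_univ, Fintype.card_fin] at h1
      omega
    simp only [Finset.mem_insert, Finset.mem_singleton, not_or] at hk
    obtain ⟨hk0, hki⟩ := hk
    have hiso := (hcomp i k hi hk0 (Ne.symm hki)).2.2.2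
    rw [hdiag, hdiag, haxis' hi, haxis' hk0, hoff hi hk0 (Ne.symm hki),
      Submodule.span_singleton_le_iff_mem] at hiso
    -- Here `v i - v 0 = p + q`, and `v 0 + v i - v k` lies in both spans whose complements contain
    -- `p` and `q`. It is therefore orthogonal to `v i - v 0`, which says that the norms of `v i`
    -- and `v 0` agree.
    obtain ⟨p, hp, q, hq, hpq⟩ := Submodule.mem_sup.1 hiso
    rw [Submodule.mem_orthogonalBilin_iff] at hp hq
    have h1 := hp (v 0 - (v k - v i)) (sub_mem
      (Submodule.mem_sup_left (Submodule.mem_span_singleton_self _))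
      (Submodule.mem_sup_right (Submodule.mem_span_singleton_self _)))
    have h2 := hq (v i - (v k - v 0)) (sub_mem
      (Submodule.mem_sup_left (Submodule.mem_span_singleton_self _))
      (Submodule.mem_sup_right (Submodule.mem_span_singleton_self _)))
    have h3 : B (v 0 + v i - v k) (v i - v 0) = 0 := by
      rw [← hpq, map_add]
      convert congrArg₂ (· + ·) h1 h2 using 3
      · abel_nf
      · abel_nf
      · simp
    simp [hvo 0 i (Ne.symm hi), hvo i 0 hi, hvo k 0 hk0, hvo k i hki] at h3
    linear_combination h3
  refine ⟨v, isAlphaBasis_one_of_norm_eq ?_ hvo hnorm, fun i j => ?_⟩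
  · rw [hvw 0, hc0 0 rfl, one_smul]
    exact hwn 0
  · unfold basisFrame
    split_ifs with hij
    · rw [← hij, hdiag]
    by_cases hi : i = 0
    · subst hi
      exact haxis' (Ne.symm hij)
    by_cases hj : j = 0
    · subst hj
      rw [(haxis i hi).2.2.2, haxis' hi, ← neg_sub, ← Set.neg_singleton, Submodule.span_neg]
    · exact hoff hi hj hij

end FrameCharacterization

/-- The set is defined by a finite disjunction: `u` is obtained by `t^k` from the orthonormal frame
`a^k(u)`, for those `k` where the coordinates of `t^k`, which are the same in every orthonormal
frame, belong to `K`. -/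
theorem proposition24 {F V : Type*} [Field F] [StarRing F] [AddCommGroup V] [Module F V]
    (B : V →ₗ⋆[F] V →ₗ[F] F) (hB : IsInnerProductForm B)
    (d n : ℕ) [NeZero d] (hd : 3 ≤ d) (hdim : Module.finrank F V = d)
    (hON : ∃ v : Module.Basis (Fin d) F V, IsAlphaBasis B (1 : Fin d → F) v)
    (ψ : starRingLang.Formula (Fin n × Fin d × Fin d)) (hψ : ψ.IsQF)
    (hhide : HidesCoordinateSystems B ψ)
    (K : Set (Fin n → Matrix (Fin d) (Fin d) F)) (hK : K = matrixSet F ψ)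
    (hinv : IsBiInvariant (1 : Fin d → F) K) :
    QFDefinableInLattice B (thetaAlpha B (1 : Fin d → F) K) := by
  obtain ⟨m, a, t, h⟩ := hhide
  rw [← hK] at h
  let good (k : Fin m) : Prop := ∃ v : Module.Basis (Fin d) F V,
    IsAlphaBasis B (1 : Fin d → F) v ∧
      (fun l => latticeEval B (t k l) fun p => basisFrame v p.1 p.2) ∈ thetaBasis v K
  have hterm (k : Fin m) (i j : Fin d) : IsTermFunction B (latticeEval B (a k i j)) :=
    ⟨a k i j, fun _ => rfl⟩
  have hQF : IsQFProperty B fun u : Fin n → Submodule F V => ∃ k,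
      -- This is `good k ∧ …`, written as an implication so that `const_imp` applies to the constant
      -- `good k`.
      ¬(good k → ¬(FrameConditions B (fun i j => latticeEval B (a k i j) u) ∧
        ∀ l, u l = latticeEval B (t k l) fun p => latticeEval B (a k p.1 p.2) u)) :=
    .exists fun k => .not <| .const_imp fun _ => .not <|
      .and (isQFProperty_frameConditions B (hterm k)) <| .forall fun l =>
        .eq ⟨.var l, fun _ => rfl⟩
          (IsTermFunction.comp (f := latticeEval B (t k l)) ⟨t k l, fun _ => rfl⟩
            fun p => hterm k p.1 p.2)
  obtain ⟨φ, hφ, hφ'⟩ := hQF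
  refine ⟨φ, hφ, fun u => Iff.trans ?_ (hφ' u)⟩
  simp only [Classical.not_imp, not_not, ← isAlphaFrame_iff_frameConditions hB hd hdim]
  constructor
  · intro hu
    obtain ⟨k, hframe, huk⟩ := h u hu
    refine ⟨k, ?_, hframe, huk⟩
    obtain ⟨v, hv, ha⟩ := hframe
    obtain ⟨w, hw, huw⟩ := hu
    refine ⟨v, hv, ?_⟩
    have : (fun l => latticeEval B (t k l) fun p => basisFrame v p.1 p.2) = u := by
      funext l
      rw [huk l]
      simp only [ha]
    rw [this]
    exact thetaBasis_subset_of_isBiInvariant hB.hermitian hw hv hinv huw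
  · rintro ⟨k, ⟨w, hw, hmem⟩, ⟨v, hv, ha⟩, huk⟩
    refine ⟨v, hv, ?_⟩
    have : u = fun l => latticeEval B (t k l) fun p => basisFrame v p.1 p.2 := by
      funext l
      rw [huk l]
      simp only [ha]
    rw [this]
    exact latticeEval_basisFrame_mem_thetaBasis hw hv (t k) hmem
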